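/- Let $\alpha,\beta>0$. An \emph{$(\alpha,\beta)$-covered domain} is a compact connected set $P\subset\mathbb{R}^2$ (possibly with holes and with a curved boundary) such that every $p\in\partial P$ is a vertex of a nondegenerate triangle $T_p\subseteq P$ all of whose angles are at least $\alpha$ and all of whose sides have length at least $\beta\cdot\mathrm{diam}(P)$, where $\mathrm{diam}$ is the Euclidean diameter. The geodesic distance $d_{\mathrm g}(p,q)$ of $p,q\in P$ is the infimum of the lengths of the paths from $p$ to $q$ inside $P$. There are constants $C$ and $k$ that depend only on $\alpha$ and $\beta$ such that the following holds for every $(\alpha,\beta)$-covered domain $P$ and every finite set $S\subset P$ of $m$ points. (i) Let $G$ be the complete graph on $S$ in which the edge $pq$ has weight $d_{\mathrm g}(p,q)$. For every $0<\varepsilon\le 1$, $G$ has a $(1+\varepsilon)$-spanner with at most $C\,m\,(1/\varepsilon)^{k}$ edges, that is, a subgraph $H$ on the vertex set $S$ with at most that many edges such that, for all $p,q\in S$, the weighted shortest-path distance of $p$ and $q$ in $H$ is at most $1+\varepsilon$ times the one in $G$. (ii) For every $s>1$ there is an $s$-well-separated pair decomposition of $S$ with respect to $d_{\mathrm g}$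 that has at most $C\,m\,s^{k}$ pairs, that is, a set of pairs $(A_i,B_i)$ of nonempty disjoint subsets of $S$ such that $s\cdot\max(\mathrm{diam}_{\mathrm g}(A_i),\mathrm{diam}_{\mathrm g}(B_i))\le d_{\mathrm g}(A_i,B_i)$ for all $i$, and for any two distinct $p,q\in S$ there is exactly one $i$ such that one of $p,q$ lies in $A_i$ and the other in $B_i$. Here $\mathrm{diam}_{\mathrm g}(A)=\max_{a,a'\in A}d_{\mathrm g}(a,a')$ and $d_{\mathrm g}(A,B)=\min_{a\in A,\,b\in B}d_{\mathrm g}(a,b)$. -/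

import Mathlib

open scoped ENNReal EuclideanGeometry

noncomputable section

/-- The Euclidean plane. -/
abbrev Plane : Type := EuclideanSpace ℝ (Fin 2)

/-- The points `a`, `b`, `c` are the vertices of a (nondegenerate) `α`-fat triangle: each of its
three angles is at least `α`. -/
def IsFatTriangle (α : ℝ) (a b c : Plane) : Prop :=
  AffineIndependent ℝ ![a, b, c] ∧ α ≤ ∠ b a c ∧ α ≤ ∠ a b c ∧ α ≤ ∠ a c b

/-- `P` is an `(α, β)`-covered domain: a compact connected set in the plane (with holes and curved
boundaries allowed) such that every boundary point `p` is a vertex of an `α`-fat triangle that is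
contained in `P` and all of whose sides have length at least `β · diam(P)`. -/
structure IsCoveredDomain (α β : ℝ) (P : Set Plane) : Prop where
  isCompact : IsCompact P
  isConnected : IsConnected P
  exists_triangle : ∀ p ∈ frontier P, ∃ q r : Plane,
    IsFatTriangle α p q r ∧ convexHull ℝ {p, q, r} ⊆ P ∧
    β * Metric.diam P ≤ dist p q ∧ β * Metric.diam P ≤ dist q r ∧ β * Metric.diam P ≤ dist r p

/-- The length of a path in the plane (its total variation). -/
def pathLength {p q : Plane} (γ : Path p q) : ℝ≥0∞ := eVariationOn γ Set.univ

/-- The geodesic distance in `P`: the infimum of the lengths of the paths from `p` to `q` that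
stay in `P`. -/
def gdist (P : Set Plane) (p q : Plane) : ℝ≥0∞ :=
  ⨅ (γ : Path p q) (_ : ∀ t, γ t ∈ P), pathLength γ

/-- The diameter of the set `A` with respect to the geodesic distance in `P`. -/
def gdiam (P A : Set Plane) : ℝ≥0∞ := ⨆ (a ∈ A) (b ∈ A), gdist P a b

/-- The distance between the sets `A` and `B` with respect to the geodesic distance in `P`. -/
def gsetDist (P A B : Set Plane) : ℝ≥0∞ := ⨅ (a ∈ A) (b ∈ B), gdist P a b

/-- The total weight of the edges along a walk, for edge weights `w`. -/
def walkWeight {V : Type*} {G : SimpleGraph V} (w : V → V → ℝ≥0∞) {u v : V} (p : G.Walk u v) :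
    ℝ≥0∞ :=
  (p.darts.map fun d => w d.fst d.snd).sum

/-- The distance in the graph `G` with edge weights `w` (infinite between vertices that are not
connected). -/
def graphDist {V : Type*} (G : SimpleGraph V) (w : V → V → ℝ≥0∞) (u v : V) : ℝ≥0∞ :=
  ⨅ p : G.Walk u v, walkWeight w p

/-- `H` is a `t`-spanner of the graph `G` with edge weights `w`: a subgraph on the same vertices
whose graph distances exceed those of `G` by a factor of at most `t`. -/
def IsSpanner {V : Type*} (G : SimpleGraph V) (w : V → V → ℝ≥0∞) (t : ℝ) (H : SimpleGraph V) :
    Prop :=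
  H ≤ G ∧ ∀ u v : V, graphDist H w u v ≤ ENNReal.ofReal t * graphDist G w u v

/-- `A` and `B` are `s`-well separated for the geodesic distance in `P`. -/
def WellSeparated (P : Set Plane) (s : ℝ) (A B : Set Plane) : Prop :=
  ENNReal.ofReal s * max (gdiam P A) (gdiam P B) ≤ gsetDist P A B

/-- `W` is an `s`-well-separated pair decomposition of the finite set `S` for the geodesic
distance in `P`: a set of pairs of nonempty, disjoint, `s`-well-separated subsets of `S` such that
any two distinct points of `S` are separated by exactly one of the pairs. -/
structure IsWSPD (P : Set Plane) (s : ℝ) (S : Finset Plane)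
    (W : Finset (Finset Plane × Finset Plane)) : Prop where
  subset : ∀ X ∈ W, X.1 ⊆ S ∧ X.2 ⊆ S
  nonempty : ∀ X ∈ W, X.1.Nonempty ∧ X.2.Nonempty
  disjoint : ∀ X ∈ W, Disjoint X.1 X.2
  wellSeparated : ∀ X ∈ W, WellSeparated P s (X.1 : Set Plane) (X.2 : Set Plane)
  existsUnique_pair : ∀ p ∈ S, ∀ q ∈ S, p ≠ q →
    ∃! X, X ∈ W ∧ ((p ∈ X.1 ∧ q ∈ X.2) ∨ (q ∈ X.1 ∧ p ∈ X.2))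

end

/-! The geometry enters only through a packing bound. At every scale `ρ` up to `β * Metric.diam P`,
each point `y` of the domain has a Euclidean disk of radius comparable to `ρ` inside `P`, all of it
within geodesic distance `2ρ` of `y`: either a ball around `y` fits, or the nearest boundary point
carries a fat triangle (`IsCoveredDomain.exists_disk`). Centres for geodesically separated points
are then Euclidean-separated, and a grid count in the plane bounds their number quadratically in the
ratio of radius to separation (`IsCoveredDomain.card_le`).

The rest is metric. In a finite metric space with such packing, take nested nets at doubling scales,
follow each point through its chain of net ancestors, and pair two clusters at the last level where
their ancestors are far apart. The two centres of a pair are still close relative to their scale, so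
one of them soon leaves the nets; as each point leaves only once, there are linearly many pairs
(`exists_wspd_of_packing`). The geodesic distance is truncated at the diameter to obtain a
real-valued metric without first showing that geodesic distances are finite. Finally, one edge per
pair gives a spanner, by induction on distance (`IsWSPD.exists_isSpanner`). -/

/-! ### Nested nets and counting of close net pairs. -/

/-- Every finite set has a subset that is `ρ`-separated and `ρ`-covers it. -/
lemma exists_net {V : Type*} (d : V → V → ℝ) (hsymm : ∀ x y, d x y = d y x)
    (T : Finset V) (hself : ∀ x ∈ T, d x x = 0) {ρ : ℝ} (hρ : 0 ≤ ρ) :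
    ∃ N ⊆ T, (∀ x ∈ N, ∀ y ∈ N, x ≠ y → ρ < d x y) ∧ ∀ x ∈ T, ∃ y ∈ N, d x y ≤ ρ := by
  classical
  let F := T.powerset.filter fun N => ∀ x ∈ N, ∀ y ∈ N, x ≠ y → ρ < d x y
  have hF : F.Nonempty := ⟨∅, by simp [F]⟩
  -- A separated subset of maximal size covers: an uncovered point could be added to it.
  obtain ⟨N, hN, hmax⟩ := F.exists_max_image Finset.card hF
  simp only [F, Finset.mem_filter, Finset.mem_powerset] at hN hmax
  refine ⟨N, hN.1, hN.2, fun x hx => ?_⟩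
  by_contra! hcon
  have hxN : x ∉ N := fun h => by
    have := hcon x h
    rw [hself x hx] at this
    linarith
  have := hmax (insert x N) ⟨Finset.insert_subset hx hN.1, by
    intro u hu v hv huv
    rcases Finset.mem_insert.1 hu with hu | hu <;> rcases Finset.mem_insert.1 hv with hv | hv
    · exact absurd (hu.trans hv.symm) huv
    · rw [hu]; exact hcon v hv
    · rw [hv, hsymm]; exact hcon u hu
    · exact hN.2 u hu v hv huv⟩
  rw [Finset.card_insert_of_notMem hxN] at this
  omega

/-- A nested hierarchy of nets at the scales `r 0, r 1, …`. -/
lemma exists_nested_nets {V : Type*} (d : V → V → ℝ) (hsymm : ∀ x y, d x y = d y x)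
    (S : Finset V) (hself : ∀ x ∈ S, d x x = 0) (r : ℕ → ℝ) (hr : ∀ i, 0 ≤ r i)
    (h0 : ∀ x ∈ S, ∀ y ∈ S, x ≠ y → r 0 < d x y) :
    ∃ N : ℕ → Finset V, N 0 = S ∧ Antitone N ∧
      (∀ i, ∀ x ∈ N i, ∀ y ∈ N i, x ≠ y → r i < d x y) ∧
      ∀ i, ∀ x ∈ N i, ∃ y ∈ N (i + 1), d x y ≤ r (i + 1) := by
  have key : ∀ (i : ℕ) (T : Finset V), ∃ N : Finset V, T ⊆ S → N ⊆ T ∧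
      (∀ x ∈ N, ∀ y ∈ N, x ≠ y → r (i + 1) < d x y) ∧ ∀ x ∈ T, ∃ y ∈ N, d x y ≤ r (i + 1) := by
    intro i T
    by_cases hT : T ⊆ S
    · obtain ⟨N, h⟩ := exists_net d hsymm T (fun x hx => hself x (hT hx)) (hr (i + 1))
      exact ⟨N, fun _ => h⟩
    · exact ⟨∅, fun h => absurd h hT⟩
  choose g hg using key
  let N : ℕ → Finset V := fun i => Nat.rec S g i
  have hN : ∀ i, N i ⊆ S := by
    intro i
    induction i with
    | zero => exact subset_rfl
    | succ i ih => exact (hg i (N i) ih).1.trans ih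
  refine ⟨N, rfl, antitone_nat_of_succ_le fun i => (hg i (N i) (hN i)).1, ?_,
    fun i => (hg i (N i) (hN i)).2.2⟩
  rintro (_ | i)
  · exact h0
  · exact (hg i (N i) (hN i)).2.1

/-- In a decreasing sequence of sets, at most `J` indices `i` have a given `x` in the `i`-th set
but not in the `(i + J)`-th one. -/
lemma card_filter_mem_not_mem_le {V : Type*} [DecidableEq V] {N : ℕ → Finset V} (hN : Antitone N)
    (J L : ℕ) (x : V) :
    ((Finset.range L).filter fun i => x ∈ N i ∧ x ∉ N (i + J)).card ≤ J := by
  set F := (Finset.range L).filter fun i => x ∈ N i ∧ x ∉ N (i + J) with hF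
  rcases F.eq_empty_or_nonempty with h | h
  · simp [h]
  -- By nestedness, all such indices lie within `J` of the smallest one: beyond that, `x` has
  -- already left.
  · have hsub : F ⊆ Finset.Ico (F.min' h) (F.min' h + J) := by
      intro i hi
      refine Finset.mem_Ico.2 ⟨F.min'_le i hi, ?_⟩
      by_contra! hcon
      have h1 := (Finset.mem_filter.1 (F.min'_mem h)).2.2
      exact h1 (hN hcon (Finset.mem_filter.1 hi).2.1)
    simpa using Finset.card_le_card hsub

/-- Counting triples `(i, x, y)` such that `x` leaves the nets at one of the levels
`i + 1, …, i + J`, when each pair `(i, x)` has at most `K` partners `y`. -/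
lemma card_triples_le {V : Type*} [DecidableEq V] {N : ℕ → Finset V} (hN : Antitone N)
    (J L K : ℕ) (T : Finset (ℕ × V × V))
    (hT : ∀ t ∈ T, t.1 < L ∧ t.2.1 ∈ N t.1 ∧ t.2.1 ∉ N (t.1 + J))
    (hK : ∀ i x, (T.filter fun t => (t.1, t.2.1) = (i, x)).card ≤ K) :
    T.card ≤ K * (J * (N 0).card) := by
  let Q := T.image fun t => (t.1, t.2.1)
  have h1 : T.card ≤ K * Q.card :=
    Finset.card_le_mul_card_image T K fun a _ => hK a.1 a.2
  have h2 : Q.card ≤ J * (Q.image Prod.snd).card := by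
    refine Finset.card_le_mul_card_image Q J fun x _ => ?_
    refine le_trans ?_ (card_filter_mem_not_mem_le hN J L x)
    refine Finset.card_le_card_of_injOn Prod.fst ?_ ?_
    · intro q hq
      obtain ⟨hqQ, rfl⟩ := Finset.mem_filter.1 (Finset.mem_coe.1 hq)
      obtain ⟨t, ht, rfl⟩ := Finset.mem_image.1 hqQ
      have := hT t ht
      simp [this.1, this.2.1, this.2.2]
    · intro q hq q' hq' h
      have e1 := (Finset.mem_filter.1 (Finset.mem_coe.1 hq)).2
      have e2 := (Finset.mem_filter.1 (Finset.mem_coe.1 hq')).2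
      exact Prod.ext h (e1.trans e2.symm)
  have h3 : (Q.image Prod.snd).card ≤ (N 0).card := by
    refine Finset.card_le_card fun x hx => ?_
    obtain ⟨q, hq, rfl⟩ := Finset.mem_image.1 hx
    obtain ⟨t, ht, rfl⟩ := Finset.mem_image.1 hq
    exact hN (Nat.zero_le _) (hT t ht).2.1
  calc T.card ≤ K * Q.card := h1
    _ ≤ K * (J * (N 0).card) := Nat.mul_le_mul_left _ (h2.trans (Nat.mul_le_mul_left _ h3))

/-- Counting close pairs in a hierarchy of nets: if balls contain at most `K` net points, the
number of triples `(i, x, y)` of net points with `d x y ≤ B * r i` is linear. -/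
lemma card_close_triples_le {V : Type*} (d : V → V → ℝ)
    (hsymm : ∀ x y, d x y = d y x) {N : ℕ → Finset V} (hN : Antitone N)
    (r0 : ℝ) (hr0 : 0 < r0) (hsep : ∀ i, ∀ x ∈ N i, ∀ y ∈ N i, x ≠ y → r0 * 2 ^ i < d x y)
    (B : ℝ) (J L K : ℕ) (hJ : B ≤ 2 ^ J)
    (hK : ∀ i, ∀ x ∈ N i, ∀ X ⊆ N i, (∀ y ∈ X, d x y ≤ B * (r0 * 2 ^ i)) → X.card ≤ K)
    (T : Finset (ℕ × V × V))
    (hT : ∀ t ∈ T, t.1 < L ∧ t.2.1 ∈ N t.1 ∧ t.2.2 ∈ N t.1 ∧ t.2.1 ≠ t.2.2 ∧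
      d t.2.1 t.2.2 ≤ B * (r0 * 2 ^ t.1)) :
    T.card ≤ 2 * (K * (J * (N 0).card)) := by
  classical
  have main : ∀ T : Finset (ℕ × V × V), (∀ t ∈ T, t.1 < L ∧ t.2.1 ∈ N t.1 ∧ t.2.2 ∈ N t.1 ∧
      t.2.1 ≠ t.2.2 ∧ d t.2.1 t.2.2 ≤ B * (r0 * 2 ^ t.1) ∧ t.2.1 ∉ N (t.1 + J)) →
      T.card ≤ K * (J * (N 0).card) := by
    intro T hT
    refine card_triples_le hN J L K T (fun t ht => ?_) fun i x => ?_
    · obtain ⟨h1, h2, -, -, -, h3⟩ := hT t ht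
      exact ⟨h1, h2, h3⟩
    · rcases (T.filter fun t => (t.1, t.2.1) = (i, x)).eq_empty_or_nonempty with h | ⟨t, ht⟩
      · rw [h]; exact Nat.zero_le K
      have hx : x ∈ N i := by
        obtain ⟨h1, h2⟩ := Finset.mem_filter.1 ht
        simp only [Prod.mk.injEq] at h2
        have := (hT t h1).2.1
        rwa [h2.1, h2.2] at this
      rw [← Finset.card_image_of_injOn (f := fun t : ℕ × V × V => t.2.2)]
      · refine hK i x hx _ ?_ ?_
        · intro y hy
          obtain ⟨t, ht, rfl⟩ := Finset.mem_image.1 hy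
          obtain ⟨h1, h2⟩ := Finset.mem_filter.1 ht
          simp only [Prod.mk.injEq] at h2
          rw [← h2.1]
          exact (hT t h1).2.2.1
        · intro y hy
          obtain ⟨t, ht, rfl⟩ := Finset.mem_image.1 hy
          obtain ⟨h1, h2⟩ := Finset.mem_filter.1 ht
          simp only [Prod.mk.injEq] at h2
          rw [← h2.1, ← h2.2]
          exact (hT t h1).2.2.2.2.1
      · intro t ht t' ht' h
        have e1 := (Finset.mem_filter.1 (Finset.mem_coe.1 ht)).2
        have e2 := (Finset.mem_filter.1 (Finset.mem_coe.1 ht')).2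
        simp only [Prod.mk.injEq] at e1 e2 h
        exact Prod.ext (e1.1.trans e2.1.symm) (Prod.ext (e1.2.trans e2.2.symm) h)
  let T1 := T.filter fun t => t.2.1 ∉ N (t.1 + J)
  let T2 := T.filter fun t => t.2.2 ∉ N (t.1 + J)
  -- If both points survived to level `t.1 + J`, they would be more than `2 ^ J * r0 * 2 ^ t.1`
  -- apart, contrary to closeness.
  have hsub : T ⊆ T1 ∪ T2 := by
    intro t ht
    obtain ⟨-, -, -, hne, hd⟩ := hT t ht
    rw [Finset.mem_union, Finset.mem_filter, Finset.mem_filter]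
    by_contra! hcon
    have h3 := hsep (t.1 + J) _ (hcon.1 ht) _ (hcon.2 ht) hne
    have : B * (r0 * 2 ^ t.1) ≤ r0 * 2 ^ (t.1 + J) := by
      rw [pow_add]
      have : 0 < r0 * 2 ^ t.1 := by positivity
      nlinarith
    linarith
  have hT1 : T1.card ≤ K * (J * (N 0).card) := by
    refine main T1 fun t ht => ?_
    obtain ⟨h1, h2⟩ := Finset.mem_filter.1 ht
    obtain ⟨a1, a2, a3, a4, a5⟩ := hT t h1
    exact ⟨a1, a2, a3, a4, a5, h2⟩
  have hT2 : T2.card ≤ K * (J * (N 0).card) := by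
    rw [← Finset.card_image_of_injective T2
      (f := fun t : ℕ × V × V => (t.1, t.2.2, t.2.1)) (by
        rintro ⟨i, x, y⟩ ⟨i', x', y'⟩ h
        simp only [Prod.mk.injEq] at h ⊢
        tauto)]
    refine main _ fun t ht => ?_
    obtain ⟨t, ht2, rfl⟩ := Finset.mem_image.1 ht
    obtain ⟨h1, h2⟩ := Finset.mem_filter.1 ht2
    obtain ⟨a1, a2, a3, a4, a5⟩ := hT t h1
    exact ⟨a1, a3, a2, a4.symm, by rw [hsymm]; exact a5, h2⟩
  calc T.card ≤ (T1 ∪ T2).card := Finset.card_le_card hsub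
    _ ≤ T1.card + T2.card := Finset.card_union_le _ _
    _ ≤ 2 * (K * (J * (N 0).card)) := by omega

/-! ### Well-separated pairs from packing. -/

/-- A finite metric space of bounded packing dimension has a well-separated pair decomposition of
linear size. -/
theorem exists_wspd_of_packing {V : Type*} [LinearOrder V] (d : V → V → ℝ)
    (hsymm : ∀ x y, d x y = d y x) (htri : ∀ x y z, d x z ≤ d x y + d y z)
    (S : Finset V) (hself : ∀ x ∈ S, d x x = 0) (hpos : ∀ x ∈ S, ∀ y ∈ S, x ≠ y → 0 < d x y)
    (K₀ : ℝ) (hK₀ : 0 ≤ K₀)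
    (hpack : ∀ x ∈ S, ∀ r B : ℝ, 0 < r → 1 ≤ B → ∀ X ⊆ S, (∀ y ∈ X, d x y ≤ B * r) →
      (∀ y ∈ X, ∀ z ∈ X, y ≠ z → r < d y z) → (X.card : ℝ) ≤ K₀ * B ^ 2)
    (s : ℝ) (hs : 1 < s) :
    ∃ W : Finset (Finset V × Finset V),
      (∀ X ∈ W, X.1 ⊆ S ∧ X.2 ⊆ S) ∧ (∀ X ∈ W, X.1.Nonempty ∧ X.2.Nonempty) ∧
      (∀ X ∈ W, Disjoint X.1 X.2) ∧
      (∀ X ∈ W, ∀ a ∈ X.1, ∀ b ∈ X.2, (∀ u ∈ X.1, ∀ v ∈ X.1, s * d u v ≤ d a b) ∧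
        ∀ u ∈ X.2, ∀ v ∈ X.2, s * d u v ≤ d a b) ∧
      (∀ p ∈ S, ∀ q ∈ S, p ≠ q →
        ∃! X, X ∈ W ∧ ((p ∈ X.1 ∧ q ∈ X.2) ∨ (q ∈ X.1 ∧ p ∈ X.2))) ∧
      (W.card : ℝ) ≤ 16800 * K₀ * S.card * s ^ 3 := by
  classical
  -- Clusters at level `i` have radius at most `2 * r i`. Centres more than `c * r i` apart leave at
  -- least `4 * s * r i` between the clusters, that is, `s` times the diameter bound `4 * r i`.
  set c : ℝ := 4 * s + 4 with hc
  have hc0 : 0 < c := by linarith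
  obtain ⟨δ, hδ0, hδ⟩ : ∃ δ : ℝ, 0 < δ ∧ ∀ x ∈ S, ∀ y ∈ S, x ≠ y → δ ≤ d x y := by
    rcases (S.offDiag).eq_empty_or_nonempty with h | h
    · refine ⟨1, one_pos, fun x hx y hy hxy => ?_⟩
      have : (x, y) ∈ S.offDiag := Finset.mem_offDiag.2 ⟨hx, hy, hxy⟩
      simp [h] at this
    · obtain ⟨⟨u, v⟩, huv, hmin⟩ := S.offDiag.exists_min_image (fun p => d p.1 p.2) h
      obtain ⟨hu, hv, hne⟩ := Finset.mem_offDiag.1 huv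
      exact ⟨d u v, hpos u hu v hv hne, fun x hx y hy hxy =>
        hmin (x, y) (Finset.mem_offDiag.2 ⟨hx, hy, hxy⟩)⟩
  obtain ⟨D, hD⟩ : ∃ D : ℝ, ∀ x ∈ S, ∀ y ∈ S, d x y ≤ D := by
    refine ⟨∑ p ∈ S ×ˢ S, |d p.1 p.2|, fun x hx y hy => (le_abs_self _).trans ?_⟩
    exact Finset.single_le_sum (f := fun p : V × V => |d p.1 p.2|) (fun p _ => abs_nonneg _)
      (Finset.mk_mem_product hx hy)
  -- With this scale, distinct points are already far at level 0, where every point is its own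
  -- ancestor.
  set r0 : ℝ := δ / (2 * c) with hr0def
  have hr0 : 0 < r0 := by positivity
  have hcr0 : c * r0 < δ := by
    rw [hr0def, mul_div_assoc', div_lt_iff₀ (by positivity)]
    nlinarith
  set r : ℕ → ℝ := fun i => r0 * 2 ^ i with hr
  have hrpos : ∀ i, 0 < r i := fun i => by simp only [hr]; positivity
  have hrsucc : ∀ i, r (i + 1) = 2 * r i := fun i => by simp only [hr]; ring
  obtain ⟨N, hN0, hNanti, hNsep, hNcov⟩ := exists_nested_nets d hsymm S hself r
    (fun i => (hrpos i).le) (fun x hx y hy hxy => by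
      have := hδ x hx y hy hxy
      simp only [hr, pow_zero, mul_one]
      nlinarith)
  have hNS : ∀ i, N i ⊆ S := fun i => hN0 ▸ hNanti (Nat.zero_le i)
  have hex : ∀ i x, ∃ y, x ∈ N i → y ∈ N (i + 1) ∧ d x y ≤ r (i + 1) := by
    intro i x
    by_cases hx : x ∈ N i
    · obtain ⟨y, hy⟩ := hNcov i x hx
      exact ⟨y, fun _ => hy⟩
    · exact ⟨x, fun h => absurd h hx⟩
  choose f hf using hex
  obtain ⟨a, ha0, hasucc⟩ : ∃ a : ℕ → V → V,
      (∀ p, a 0 p = p) ∧ ∀ i p, a (i + 1) p = f i (a i p) :=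
    ⟨fun i p => Nat.rec p f i, fun _ => rfl, fun _ _ => rfl⟩
  have haN : ∀ p ∈ S, ∀ i, a i p ∈ N i := by
    intro p hp i
    induction i with
    | zero => rw [ha0, hN0]; exact hp
    | succ i ih => rw [hasucc]; exact (hf i _ ih).1
  have had : ∀ p ∈ S, ∀ i, d p (a i p) ≤ 2 * r i := by
    intro p hp i
    induction i with
    | zero => rw [ha0, hself p hp]; linarith [hrpos 0]
    | succ i ih =>
      have h1 := (hf i _ (haN p hp i)).2
      have h2 := htri p (a i p) (a (i + 1) p)
      rw [hasucc] at h2 ⊢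
      rw [hrsucc] at h1 ⊢
      linarith
  let Far : ℕ → V → V → Prop := fun i p q => c * r i < d (a i p) (a i q)
  have hmono : ∀ p ∈ S, ∀ q ∈ S, ∀ i, Far (i + 1) p q → Far i p q := by
    intro p hp q hq i h
    simp only [Far] at h ⊢
    have h1 := (hf i _ (haN p hp i)).2
    have h2 := (hf i _ (haN q hq i)).2
    rw [← hasucc, hrsucc] at h1 h2
    have h3 := htri (a (i + 1) p) (a i p) (a (i + 1) q)
    have h4 := htri (a i p) (a i q) (a (i + 1) q)
    rw [hsymm _ (a i p)] at h3
    rw [hrsucc] at h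
    have := hrpos i
    nlinarith
  have hanti : ∀ p ∈ S, ∀ q ∈ S, ∀ i j, i ≤ j → Far j p q → Far i p q := by
    intro p hp q hq i j hij
    induction hij with
    | refl => exact id
    | step _ ih => exact fun h => ih (hmono p hp q hq _ h)
  obtain ⟨L, hL⟩ : ∃ L : ℕ, ∀ p ∈ S, ∀ q ∈ S, ¬ Far L p q := by
    obtain ⟨L, hL⟩ := pow_unbounded_of_one_lt (D / (c * r0)) (one_lt_two)
    refine ⟨L, fun p hp q hq h => ?_⟩
    simp only [Far] at h
    have h1 := hD _ (hNS _ (haN p hp L)) _ (hNS _ (haN q hq L))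
    rw [div_lt_iff₀ (by positivity)] at hL
    simp only [hr] at h
    nlinarith
  let cl : ℕ → V → Finset V := fun i x => {p ∈ S | a i p = x}
  -- A triple records the last level at which two ancestors are far; the order on `V` lists each
  -- unordered pair of centres once.
  let T : Finset (ℕ × V × V) := (Finset.range L ×ˢ S ×ˢ S).filter fun t =>
    t.2.1 < t.2.2 ∧ (∃ p ∈ S, ∃ q ∈ S, a t.1 p = t.2.1 ∧ a t.1 q = t.2.2) ∧
      c * r t.1 < d t.2.1 t.2.2 ∧ d (f t.1 t.2.1) (f t.1 t.2.2) ≤ c * r (t.1 + 1)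
  let F : ℕ × V × V → Finset V × Finset V := fun t => (cl t.1 t.2.1, cl t.1 t.2.2)
  have hmemT : ∀ t, t ∈ T ↔ (t.1 < L ∧ t.2.1 ∈ S ∧ t.2.2 ∈ S) ∧ t.2.1 < t.2.2 ∧
      (∃ p ∈ S, ∃ q ∈ S, a t.1 p = t.2.1 ∧ a t.1 q = t.2.2) ∧
      c * r t.1 < d t.2.1 t.2.2 ∧ d (f t.1 t.2.1) (f t.1 t.2.2) ≤ c * r (t.1 + 1) := by
    intro t
    simp only [T, Finset.mem_filter, Finset.mem_product, Finset.mem_range]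
  have hmemW : ∀ X ∈ T.image F, ∃ t ∈ T, X.1 = cl t.1 t.2.1 ∧ X.2 = cl t.1 t.2.2 := by
    intro X hX
    obtain ⟨t, ht, rfl⟩ := Finset.mem_image.1 hX
    exact ⟨t, ht, rfl, rfl⟩
  have hmemcl : ∀ i x p, p ∈ cl i x ↔ p ∈ S ∧ a i p = x := fun i x p => by
    simp only [cl, Finset.mem_filter]
  refine ⟨T.image F, ?_, ?_, ?_, ?_, ?_, ?_⟩
  · intro X hX
    obtain ⟨t, -, h1, h2⟩ := hmemW X hX
    rw [h1, h2]
    exact ⟨S.filter_subset (a t.1 · = _), S.filter_subset (a t.1 · = _)⟩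
  · intro X hX
    obtain ⟨t, ht, h1, h2⟩ := hmemW X hX
    obtain ⟨-, -, ⟨p, hp, q, hq, hpx, hqy⟩, -⟩ := (hmemT t).1 ht
    rw [h1, h2]
    exact ⟨⟨p, (hmemcl _ _ _).2 ⟨hp, hpx⟩⟩, ⟨q, (hmemcl _ _ _).2 ⟨hq, hqy⟩⟩⟩
  · intro X hX
    obtain ⟨t, ht, h1, h2⟩ := hmemW X hX
    rw [h1, h2, Finset.disjoint_left]
    intro p hp hq
    have e1 := ((hmemcl _ _ _).1 hp).2
    have e2 := ((hmemcl _ _ _).1 hq).2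
    exact ((hmemT t).1 ht).2.1.ne (e1.symm.trans e2)
  · intro X hX x hx y hy
    obtain ⟨t, ht, h1, h2⟩ := hmemW X hX
    obtain ⟨-, -, -, hfar, -⟩ := (hmemT t).1 ht
    rw [h1] at hx
    rw [h2] at hy
    rw [h1, h2]
    have hcen : ∀ z u, u ∈ cl t.1 z → d u z ≤ 2 * r t.1 := by
      intro z u hu
      obtain ⟨huS, rfl⟩ := (hmemcl _ _ _).1 hu
      exact had u huS t.1
    have hdiam : ∀ z u v, u ∈ cl t.1 z → v ∈ cl t.1 z → d u v ≤ 4 * r t.1 := by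
      intro z u v hu hv
      have := htri u z v
      have h3 := hcen z u hu
      have h4 := hcen z v hv
      rw [hsymm] at h4
      linarith
    have hxy : 4 * s * r t.1 ≤ d x y := by
      have h3 := htri t.2.1 x t.2.2
      have h4 := htri x y t.2.2
      have h5 := hcen _ x hx
      have h6 := hcen _ y hy
      rw [hsymm t.2.1 x] at h3
      simp only [hc] at hfar
      nlinarith
    constructor <;> intro u hu v hv
    · have := hdiam _ u v hu hv
      nlinarith
    · have := hdiam _ u v hu hv
      nlinarith
  -- Farness is inherited by lower levels, so it switches off exactly once. This determines the
  -- level, and the ancestors of `p` and `q` there determine the triple.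
  · have huniq : ∀ p ∈ S, ∀ q ∈ S, p ≠ q → ∃ i, Far i p q ∧ ¬ Far (i + 1) p q ∧ i < L ∧
        ∀ t ∈ T, ((p ∈ (F t).1 ∧ q ∈ (F t).2) ∨ (q ∈ (F t).1 ∧ p ∈ (F t).2)) →
          t = (i, min (a i p) (a i q), max (a i p) (a i q)) := by
      intro p hp q hq hpq
      have hfar0 : Far 0 p q := by
        simp only [Far, ha0, hr, pow_zero, mul_one]
        linarith [hδ p hp q hq hpq]
      have hexi : ∃ n, ¬ Far n p q := ⟨L, hL p hp q hq⟩
      obtain ⟨i, hi⟩ : ∃ i, Nat.find hexi = i + 1 :=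
        Nat.exists_eq_succ_of_ne_zero fun h => Nat.find_spec hexi (h ▸ hfar0)
      have hfi : Far i p q := not_not.1 (Nat.find_min hexi (by omega))
      have hfi' : ¬ Far (i + 1) p q := hi ▸ Nat.find_spec hexi
      refine ⟨i, hfi, hfi', ?_, ?_⟩
      · by_contra! h
        exact hL p hp q hq (hanti p hp q hq L i h hfi)
      · intro t ht hcase
        obtain ⟨-, hlt, -, h3, h4⟩ := (hmemT t).1 ht
        have hj : Far t.1 p q ∧ ¬ Far (t.1 + 1) p q := by
          simp only [Far, not_lt, hasucc]
          rcases hcase with ⟨h1, h2⟩ | ⟨h1, h2⟩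
          · rw [((hmemcl _ _ _).1 h1).2, ((hmemcl _ _ _).1 h2).2]
            exact ⟨h3, h4⟩
          · rw [((hmemcl _ _ _).1 h1).2, ((hmemcl _ _ _).1 h2).2, hsymm _ t.2.1,
              hsymm _ (f t.1 t.2.1)]
            exact ⟨h3, h4⟩
        have hti : t.1 = i := by
          rcases lt_trichotomy t.1 i with h | h | h
          · exact absurd (hanti p hp q hq _ _ h hfi) hj.2
          · exact h
          · exact absurd (hanti p hp q hq _ _ h hj.1) hfi'
        obtain ⟨i', x, y⟩ := t
        simp only at hti hlt
        subst hti
        rcases hcase with ⟨h1, h2⟩ | ⟨h1, h2⟩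
        · have e1 := ((hmemcl _ _ _).1 h1).2
          have e2 := ((hmemcl _ _ _).1 h2).2
          simp only at e1 e2
          rw [e1, e2, min_eq_left hlt.le, max_eq_right hlt.le]
        · have e1 := ((hmemcl _ _ _).1 h1).2
          have e2 := ((hmemcl _ _ _).1 h2).2
          simp only at e1 e2
          rw [e1, e2, min_eq_right hlt.le, max_eq_left hlt.le]
    intro p hp q hq hpq
    obtain ⟨i, h1, h2, h3, h4⟩ := huniq p hp q hq hpq
    have hp' := hNS _ (haN p hp i)
    have hq' := hNS _ (haN q hq i)
    simp only [Far, not_lt, hasucc] at h1 h2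
    have hne : a i p ≠ a i q := by
      intro h
      rw [h, hself _ hq'] at h1
      have := hrpos i
      nlinarith
    have hmem : ∃ t ∈ T, ((p ∈ (F t).1 ∧ q ∈ (F t).2) ∨ (q ∈ (F t).1 ∧ p ∈ (F t).2)) := by
      rcases hne.lt_or_gt with h | h
      · refine ⟨(i, a i p, a i q), (hmemT _).2 ⟨⟨h3, hp', hq'⟩, h,
          ⟨p, hp, q, hq, rfl, rfl⟩, h1, h2⟩, Or.inl ⟨?_, ?_⟩⟩
        · exact (hmemcl _ _ _).2 ⟨hp, rfl⟩
        · exact (hmemcl _ _ _).2 ⟨hq, rfl⟩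
      · refine ⟨(i, a i q, a i p), (hmemT _).2 ⟨⟨h3, hq', hp'⟩, h,
          ⟨q, hq, p, hp, rfl, rfl⟩, by rw [hsymm]; exact h1, by rw [hsymm]; exact h2⟩,
          Or.inr ⟨?_, ?_⟩⟩
        · exact (hmemcl _ _ _).2 ⟨hq, rfl⟩
        · exact (hmemcl _ _ _).2 ⟨hp, rfl⟩
    obtain ⟨t, ht, hcase⟩ := hmem
    refine ⟨F t, ⟨Finset.mem_image_of_mem F ht, hcase⟩, ?_⟩
    rintro X ⟨hX, hX'⟩
    obtain ⟨t', ht', rfl⟩ := Finset.mem_image.1 hX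
    rw [h4 t ht hcase, h4 t' ht' hX']
  -- Parents are within `c * r (i + 1) = 2 * c * r i` of each other, and each step to a parent costs
  -- at most `2 * r i`.
  · set B : ℝ := 2 * c + 4 with hB
    have hB1 : 1 ≤ B := by linarith
    -- A crude choice, as a logarithm of `B` would do; it costs the third power of `s` in the bound.
    set J := ⌈B⌉₊ with hJ
    have hJB : B ≤ 2 ^ J := by
      refine (Nat.le_ceil B).trans ?_
      exact_mod_cast (Nat.lt_two_pow_self (n := J)).le
    have hcard := card_close_triples_le d hsymm hNanti r0 hr0 hNsep B J L ⌊K₀ * B ^ 2⌋₊ hJB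
      (fun i x hx X hX hd => Nat.le_floor (hpack x (hNS i hx) _ B (hrpos i) hB1 X
        (hX.trans (hNS i)) hd fun y hy z hz => hNsep i y (hX hy) z (hX hz))) T (by
      intro t ht
      obtain ⟨⟨hi, -, -⟩, hlt, ⟨p, hp, q, hq, hpx, hqy⟩, -, hle⟩ := (hmemT t).1 ht
      have hx : t.2.1 ∈ N t.1 := hpx ▸ haN p hp _
      have hy : t.2.2 ∈ N t.1 := hqy ▸ haN q hq _
      refine ⟨hi, hx, hy, hlt.ne, ?_⟩
      have h1 := (hf _ _ hx).2
      have h2 := (hf _ _ hy).2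
      have h3 := htri t.2.1 (f t.1 t.2.1) t.2.2
      have h4 := htri (f t.1 t.2.1) (f t.1 t.2.2) t.2.2
      rw [hsymm (f t.1 t.2.2) t.2.2] at h4
      rw [hrsucc] at h1 h2 hle
      change d t.2.1 t.2.2 ≤ B * r t.1
      rw [hB]
      nlinarith)
    rw [hN0] at hcard
    have hJ' : (J : ℝ) ≤ 21 * s := by
      have := Nat.ceil_lt_add_one (show 0 ≤ B by linarith)
      linarith
    have hB' : B ≤ 20 * s := by linarith
    have hK' : ((⌊K₀ * B ^ 2⌋₊ : ℕ) : ℝ) ≤ K₀ * (20 * s) ^ 2 :=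
      (Nat.floor_le (by positivity)).trans (by gcongr)
    calc ((T.image F).card : ℝ) ≤ T.card := by exact_mod_cast Finset.card_image_le
      _ ≤ 2 * ((⌊K₀ * B ^ 2⌋₊ : ℕ) * (J * S.card)) := by exact_mod_cast hcard
      _ ≤ 2 * ((K₀ * (20 * s) ^ 2) * ((21 * s) * S.card)) := by gcongr
      _ = 16800 * K₀ * S.card * s ^ 3 := by ring

/-! ### Path length and geodesic distance. -/

/-- Variation is additive when the interval is cut at `1/2`, and on each half the concatenation is a
monotone reparametrization of one of the paths. -/
lemma pathLength_trans_le {p q r : Plane} (γ : Path p q) (γ' : Path q r) :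
    pathLength (γ.trans γ') ≤ pathLength γ + pathLength γ' := by
  let h : unitInterval := ⟨1 / 2, by norm_num, by norm_num⟩
  have e : (Set.univ : Set unitInterval) = Set.Iic h ∪ Set.Ici h := Set.Iic_union_Ici.symm
  have hmono1 : Monotone fun t : unitInterval =>
      Set.projIcc (0 : ℝ) 1 zero_le_one (2 * (t : ℝ)) := fun s t hst =>
    Set.monotone_projIcc _ (by have : (s : ℝ) ≤ t := hst; linarith)
  have hmono2 : Monotone fun t : unitInterval =>
      Set.projIcc (0 : ℝ) 1 zero_le_one (2 * (t : ℝ) - 1) := fun s t hst =>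
    Set.monotone_projIcc _ (by have : (s : ℝ) ≤ t := hst; linarith)
  unfold pathLength
  conv_lhs => rw [e]
  rw [eVariationOn.union _ isGreatest_Iic isLeast_Ici]
  refine add_le_add ?_ ?_
  · have : Set.EqOn (γ.trans γ')
        (γ ∘ fun t : unitInterval => Set.projIcc (0 : ℝ) 1 zero_le_one (2 * (t : ℝ)))
        (Set.Iic h) := fun t ht => by
      have h2 := Path.extend_trans_of_le_half γ γ' (t := (t : ℝ)) ht
      rwa [Path.extend_apply _ t.2] at h2
    rw [eVariationOn.congr this]
    exact eVariationOn.comp_le_of_monotoneOn _ _ (hmono1.monotoneOn _) (Set.mapsTo_univ _ _)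
  · have : Set.EqOn (γ.trans γ')
        (γ' ∘ fun t : unitInterval => Set.projIcc (0 : ℝ) 1 zero_le_one (2 * (t : ℝ) - 1))
        (Set.Ici h) := fun t ht => by
      have h2 := Path.extend_trans_of_half_le γ γ' (t := (t : ℝ)) ht
      rwa [Path.extend_apply _ t.2] at h2
    rw [eVariationOn.congr this]
    exact eVariationOn.comp_le_of_monotoneOn _ _ (hmono2.monotoneOn _) (Set.mapsTo_univ _ _)

lemma pathLength_symm_le {p q : Plane} (γ : Path p q) : pathLength γ.symm ≤ pathLength γ :=
  eVariationOn.comp_le_of_antitoneOn γ unitInterval.symm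
    (fun _ _ _ _ h => unitInterval.symm_le_symm.2 h) (Set.mapsTo_univ _ _)

lemma gdist_le {P : Set Plane} {p q : Plane} (γ : Path p q) (h : ∀ t, γ t ∈ P) :
    gdist P p q ≤ pathLength γ :=
  iInf₂_le γ h

lemma gdist_comm (P : Set Plane) (p q : Plane) : gdist P p q = gdist P q p := by
  have key : ∀ p q, gdist P p q ≤ gdist P q p := fun p q =>
    le_iInf₂ fun γ hγ => (gdist_le γ.symm fun t => hγ _).trans (pathLength_symm_le γ)
  exact le_antisymm (key p q) (key q p)

lemma gdist_triangle (P : Set Plane) (p q r : Plane) :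
    gdist P p r ≤ gdist P p q + gdist P q r := by
  unfold gdist
  simp only [ENNReal.iInf_add, ENNReal.add_iInf]
  refine le_iInf₂ fun γ' hγ' => le_iInf₂ fun γ hγ => ?_
  refine (gdist_le (γ.trans γ') fun t => ?_).trans (pathLength_trans_le γ γ')
  have := Path.trans_range γ γ' ▸ Set.mem_range_self (f := γ.trans γ') t
  rcases this with ⟨s, hs⟩ | ⟨s, hs⟩
  · exact hs ▸ hγ s
  · exact hs ▸ hγ' s

lemma edist_le_gdist (P : Set Plane) (p q : Plane) : edist p q ≤ gdist P p q := by
  refine le_iInf₂ fun γ _ => ?_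
  have := eVariationOn.edist_le γ (Set.mem_univ (0 : unitInterval)) (Set.mem_univ 1)
  rwa [γ.source, γ.target] at this

lemma gdist_le_edist {P : Set Plane} {p q : Plane} (h : segment ℝ p q ⊆ P) :
    gdist P p q ≤ edist p q := by
  let γ : Path p q :=
    { toFun := fun t => AffineMap.lineMap p q (t : ℝ)
      continuous_toFun := by fun_prop
      source' := by simp
      target' := by simp }
  have hγ : ∀ t, γ t ∈ P := fun t => h <| by
    rw [segment_eq_image_lineMap]
    exact ⟨t, t.2, rfl⟩
  refine (gdist_le γ hγ).trans ?_
  have h1 : pathLength γ ≤ (nndist p q : ℝ≥0∞) *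
      eVariationOn (Subtype.val : unitInterval → ℝ) Set.univ :=
    LipschitzOnWith.comp_eVariationOn_le (f := fun t : ℝ => AffineMap.lineMap p q t)
      (t := Set.univ) ((lipschitzWith_lineMap p q).lipschitzOnWith) (Set.mapsTo_univ _ _)
  have h2 : eVariationOn (Subtype.val : unitInterval → ℝ) Set.univ ≤ 1 := by
    have := MonotoneOn.eVariationOn_eq (f := (Subtype.val : unitInterval → ℝ)) (s := Set.univ)
      (fun _ _ _ _ h => h) (Set.mem_univ 0) (Set.mem_univ 1)
    have e : (Set.univ : Set unitInterval) ∩ Set.Icc 0 1 = Set.univ := by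
      ext t
      exact ⟨fun _ => trivial, fun _ => ⟨trivial, t.2⟩⟩
    rw [e] at this
    simp [this]
  calc pathLength γ ≤ nndist p q * 1 := h1.trans (by gcongr)
    _ = edist p q := by rw [mul_one, edist_nndist]

lemma gdist_self {P : Set Plane} {p : Plane} (h : p ∈ P) : gdist P p p = 0 := by
  have := gdist_le_edist (P := P) (p := p) (q := p) (by simpa using h)
  simpa using this

/-! ### Fat disks in triangles and in covered domains. -/

/-- A triangle spanned by two vectors of length `ρ` that enclose an angle between `α` and
`π - α` contains a disk of radius `ρ sin α / 6` around its centroid. -/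
lemma exists_coords_of_near_centroid {α ρ : ℝ} (hα : 0 < α) (hαπ : α < Real.pi) (hρ : 0 < ρ)
    {e₁ e₂ : Plane} (h₁ : ‖e₁‖ = ρ) (h₂ : ‖e₂‖ = ρ) (hθ : α ≤ InnerProductGeometry.angle e₁ e₂)
    (hθ' : InnerProductGeometry.angle e₁ e₂ ≤ Real.pi - α)
    {v : Plane} (hv : ‖v‖ ≤ Real.sin α / 6 * ρ) :
    ∃ a b : ℝ, 0 ≤ a ∧ 0 ≤ b ∧ a + b ≤ 1 ∧ (1 / 3 : ℝ) • (e₁ + e₂) + v = a • e₁ + b • e₂ := by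
  have hs0 : 0 < Real.sin α := Real.sin_pos_of_pos_of_lt_pi hα hαπ
  set θ := InnerProductGeometry.angle e₁ e₂ with hθdef
  have hsin : Real.sin α ≤ Real.sin θ := by
    rcases le_total θ (Real.pi / 2) with h | h
    · exact Real.sin_le_sin_of_le_of_le_pi_div_two (by linarith) h hθ
    · rw [← Real.sin_pi_sub θ]
      exact Real.sin_le_sin_of_le_of_le_pi_div_two (by linarith) (by linarith) (by linarith)
  have hsq : ∀ w : Plane, ‖w‖ ^ 2 = w 0 ^ 2 + w 1 ^ 2 := fun w => by
    simp [EuclideanSpace.norm_sq_eq, Fin.sum_univ_two]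
  have hinner : e₁ 0 * e₂ 0 + e₁ 1 * e₂ 1 = Real.cos θ * ρ ^ 2 := by
    have := InnerProductGeometry.cos_angle_mul_norm_mul_norm e₁ e₂
    rw [h₁, h₂] at this
    simp only [PiLp.inner_apply, Fin.sum_univ_two, RCLike.inner_apply, conj_trivial] at this
    rw [hθdef]
    linarith
  have n1 := hsq e₁
  have n2 := hsq e₂
  rw [h₁] at n1
  rw [h₂] at n2
  -- The determinant has absolute value `ρ ^ 2 * sin θ` by Lagrange's identity. Cramer's rule then
  -- bounds each coordinate of `v` by `1/6`, which the centroid coordinates `1/3` absorb in all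
  -- three constraints.
  set D := e₁ 0 * e₂ 1 - e₁ 1 * e₂ 0 with hD
  have hD2 : D ^ 2 = (ρ ^ 2 * Real.sin θ) ^ 2 := by
    have : D ^ 2 + (e₁ 0 * e₂ 0 + e₁ 1 * e₂ 1) ^ 2 = ρ ^ 2 * ρ ^ 2 := by
      nth_rewrite 1 [n1]
      rw [n2, hD]
      ring
    rw [hinner] at this
    have hcs := Real.sin_sq_add_cos_sq θ
    linear_combination this - ρ ^ 4 * hcs
  have hDabs : ρ ^ 2 * Real.sin α ≤ |D| := by
    have h0 : 0 ≤ ρ ^ 2 * Real.sin θ := by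
      have := hs0.le.trans hsin
      positivity
    rw [(sq_eq_sq_iff_abs_eq_abs _ _).1 hD2, abs_of_nonneg h0]
    gcongr
  have hDpos : 0 < |D| := lt_of_lt_of_le (by positivity) hDabs
  have hD0 : D ≠ 0 := abs_pos.1 hDpos
  have bound : ∀ w : Plane, ‖w‖ = ρ → |(v 0 * w 1 - v 1 * w 0) / D| ≤ 1 / 6 := by
    intro w hw
    have nv := hsq v
    have nw := hsq w
    rw [abs_div, div_le_iff₀ hDpos]
    have h1 : (v 0 * w 1 - v 1 * w 0) ^ 2 ≤ (‖v‖ * ‖w‖) ^ 2 := by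
      rw [mul_pow, nv, nw]
      nlinarith [sq_nonneg (v 0 * w 0 + v 1 * w 1)]
    have h3 := abs_le_of_sq_le_sq h1 (by positivity)
    rw [hw] at h3
    nlinarith
  set a := (v 0 * e₂ 1 - v 1 * e₂ 0) / D with ha
  set b := -((v 0 * e₁ 1 - v 1 * e₁ 0) / D) with hb
  have ba := abs_le.1 (bound e₂ h₂)
  have bb := abs_le.1 (bound e₁ h₁)
  refine ⟨1 / 3 + a, 1 / 3 + b, by linarith, by linarith, by linarith, ?_⟩
  have hvv : v = a • e₁ + b • e₂ := by
    ext i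
    fin_cases i <;> simp [ha, hb] <;> field_simp <;> rw [hD] <;> ring
  rw [hvv]
  module

/-- A fat triangle contains, at every small scale `ρ`, a fat disk within distance `ρ` of a given
vertex. -/
lemma IsFatTriangle.exists_disk {α ρ : ℝ} (hα : 0 < α) (hρ : 0 < ρ) {z q r : Plane}
    (h : IsFatTriangle α z q r) (hq : ρ ≤ dist z q) (hr : ρ ≤ dist r z) :
    0 < Real.sin α ∧ ∃ w : Plane, ∀ y, dist y w ≤ Real.sin α / 6 * ρ →
      y ∈ convexHull ℝ {z, q, r} ∧ dist z y ≤ ρ := by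
  obtain ⟨-, h1, h2, -⟩ := h
  have hzq : 0 < ‖q - z‖ := by rw [← dist_eq_norm, dist_comm]; linarith
  have hzr : 0 < ‖r - z‖ := by rw [← dist_eq_norm]; linarith
  have hne : q ≠ z := fun e => by simp [e] at hzq
  have hsum := EuclideanGeometry.angle_add_angle_add_angle_eq_pi r hne
  have hθ' : ∠ q z r ≤ Real.pi - α := by
    have := EuclideanGeometry.angle_nonneg q r z
    have e1 := EuclideanGeometry.angle_comm r z q
    linarith
  have hαπ : α < Real.pi := by linarith
  -- Both sides at `z` are shortened to length `ρ`, giving a smaller triangle with the same angle at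
  -- `z`.
  set t₁ := ρ / ‖q - z‖ with ht1
  set t₂ := ρ / ‖r - z‖ with ht2
  have pt1 : 0 < t₁ := by positivity
  have pt2 : 0 < t₂ := by positivity
  have lt1 : t₁ ≤ 1 := by
    rw [ht1, div_le_one hzq, ← dist_eq_norm, dist_comm]
    exact hq
  have lt2 : t₂ ≤ 1 := by
    rw [ht2, div_le_one hzr, ← dist_eq_norm]
    exact hr
  have n1 : ‖t₁ • (q - z)‖ = ρ := by
    rw [norm_smul, Real.norm_of_nonneg pt1.le, ht1, div_mul_cancel₀ _ hzq.ne']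
  have n2 : ‖t₂ • (r - z)‖ = ρ := by
    rw [norm_smul, Real.norm_of_nonneg pt2.le, ht2, div_mul_cancel₀ _ hzr.ne']
  have hang : InnerProductGeometry.angle (t₁ • (q - z)) (t₂ • (r - z)) = ∠ q z r := by
    rw [InnerProductGeometry.angle_smul_left_of_pos _ _ pt1,
      InnerProductGeometry.angle_smul_right_of_pos _ _ pt2]
    rfl
  refine ⟨Real.sin_pos_of_pos_of_lt_pi hα hαπ,
    z + (1 / 3 : ℝ) • (t₁ • (q - z) + t₂ • (r - z)), fun y hy => ?_⟩
  obtain ⟨a, b, ha, hb, hab, heq⟩ := exists_coords_of_near_centroid hα hαπ hρ n1 n2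
    (by rw [hang]; exact h1) (by rw [hang]; exact hθ')
    (v := y - (z + (1 / 3 : ℝ) • (t₁ • (q - z) + t₂ • (r - z)))) (by rwa [← dist_eq_norm])
  have hyz : y = z + (a • (t₁ • (q - z)) + b • (t₂ • (r - z))) := by
    rw [← heq]
    module
  constructor
  · have hsum1 : a * t₁ + b * t₂ ≤ 1 := by nlinarith
    have : y = (1 - a * t₁ - b * t₂) • z + (a * t₁) • q + (b * t₂) • r := by
      rw [hyz]
      module
    have hmem := (convex_convexHull ℝ {z, q, r}).sum_mem (t := Finset.univ)
      (w := ![1 - a * t₁ - b * t₂, a * t₁, b * t₂]) (z := ![z, q, r])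
      (by
        have h1 : 0 ≤ a * t₁ := by positivity
        have h2 : 0 ≤ b * t₂ := by positivity
        intro i _
        fin_cases i <;> simp <;> linarith)
      (by simp [Fin.sum_univ_three]; ring)
      (by
        intro i _
        refine subset_convexHull ℝ _ ?_
        fin_cases i <;> simp)
    rw [this]
    simpa [Fin.sum_univ_three] using hmem
  · rw [dist_comm, dist_eq_norm, hyz, add_sub_cancel_left]
    calc ‖a • (t₁ • (q - z)) + b • (t₂ • (r - z))‖
        ≤ ‖a • (t₁ • (q - z))‖ + ‖b • (t₂ • (r - z))‖ := norm_add_le _ _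
      _ = a * ρ + b * ρ := by
        rw [norm_smul a, norm_smul b, n1, n2, Real.norm_of_nonneg ha, Real.norm_of_nonneg hb]
      _ ≤ ρ := by nlinarith

/-- In a covered domain, every point `x` has at every small scale `ρ` a fat disk in the domain all
of whose points have geodesic distance at most `2ρ` to `x`. -/
lemma IsCoveredDomain.exists_disk {α β ρ : ℝ} (hα : 0 < α) {P : Set Plane}
    (hP : IsCoveredDomain α β P) (hρ : 0 < ρ) (hρβ : ρ ≤ β * Metric.diam P) {x : Plane}
    (hx : x ∈ P) :
    ∃ w : Plane, ∀ y, dist y w ≤ Real.sin α / 6 * ρ →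
      y ∈ P ∧ gdist P x y ≤ ENNReal.ofReal (2 * ρ) := by
  have hcross : ∀ y ∉ P, ∃ f ∈ frontier P, dist x f ≤ dist x y := by
    intro y hy
    obtain ⟨f, hf, hfP⟩ : ∃ f ∈ segment ℝ x y, f ∈ frontier P := by
      by_contra! hcon
      have hint : ∀ v ∈ segment ℝ x y, v ∈ P → v ∈ interior P := fun v hv hvP => by
        by_contra h
        exact hcon v hv ⟨subset_closure hvP, h⟩
      have := (convex_segment (𝕜 := ℝ) x y).isPreconnected.subset_left_of_subset_union
        isOpen_interior hP.isCompact.isClosed.isOpen_compl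
        (Set.disjoint_left.2 fun v hv hv' => hv' (interior_subset hv))
        (fun v hv => (em (v ∈ P)).imp (hint v hv) id)
        ⟨x, left_mem_segment ℝ x y, hint x (left_mem_segment ℝ x y) hx⟩
      exact hy (interior_subset (this (right_mem_segment ℝ x y)))
    have := (convex_closedBall x (dist x y)).segment_subset
      (Metric.mem_closedBall_self dist_nonneg) (Metric.mem_closedBall'.2 le_rfl) hf
    exact ⟨f, hfP, Metric.mem_closedBall'.1 this⟩
  by_cases hball : Metric.ball x ρ ⊆ P
  · refine ⟨x, fun y hy => ?_⟩
    have hlt : dist y x < ρ := by nlinarith [Real.sin_le_one α]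
    have hyb : y ∈ Metric.ball x ρ := hlt
    refine ⟨hball hyb, (gdist_le_edist (((convex_ball x ρ).segment_subset
      (Metric.mem_ball_self hρ) hyb).trans hball)).trans ?_⟩
    rw [edist_dist, dist_comm]
    exact ENNReal.ofReal_le_ofReal (by linarith)
  · obtain ⟨u, hu, huP⟩ := Set.not_subset.1 hball
    obtain ⟨f, hf, hfu⟩ := hcross u huP
    obtain ⟨z, hz, hxz⟩ := isClosed_frontier.exists_infDist_eq_dist ⟨f, hf⟩ x
    have hmin : ∀ f ∈ frontier P, dist x z ≤ dist x f := fun f hf =>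
      hxz ▸ Metric.infDist_le_dist_of_mem hf
    have hxzρ : dist x z < ρ :=
      ((hmin f hf).trans hfu).trans_lt (Metric.mem_ball'.1 hu)
    have hzP : z ∈ P := hP.isCompact.isClosed.frontier_subset hz
    -- A point of the segment outside `P` would produce a boundary point no farther from `x` than
    -- itself; minimality of `z` forces it to equal `z`, which lies in `P`.
    have hseg : segment ℝ x z ⊆ P := by
      intro v hv
      by_contra hvP
      obtain ⟨g, hg, hgv⟩ := hcross v hvP
      have h1 := (hmin g hg).trans hgv
      have h2 := dist_add_dist_of_mem_segment hv
      have h3 : dist v z = 0 := le_antisymm (by linarith) dist_nonneg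
      exact hvP (dist_eq_zero.1 h3 ▸ hzP)
    obtain ⟨q, r, hfat, hsub, hq, -, hr⟩ := hP.exists_triangle z hz
    obtain ⟨-, w, hw⟩ := hfat.exists_disk hα hρ (hρβ.trans hq) (hρβ.trans hr)
    refine ⟨w, fun y hy => ?_⟩
    obtain ⟨hy1, hy2⟩ := hw y hy
    refine ⟨hsub hy1, ?_⟩
    have hzy : segment ℝ z y ⊆ P := ((convex_convexHull ℝ _).segment_subset
      (subset_convexHull ℝ _ (by simp)) hy1).trans hsub
    calc gdist P x y ≤ gdist P x z + gdist P z y := gdist_triangle P x z y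
      _ ≤ edist x z + edist z y := add_le_add (gdist_le_edist hseg) (gdist_le_edist hzy)
      _ = ENNReal.ofReal (dist x z + dist z y) := by
        rw [edist_dist, edist_dist, ENNReal.ofReal_add dist_nonneg dist_nonneg]
      _ ≤ ENNReal.ofReal (2 * ρ) := ENNReal.ofReal_le_ofReal (by linarith)

/-- A nonempty compact set has a boundary point, since the plane is not compact; the triangle there
has sides between `β * Metric.diam P` and `Metric.diam P`. -/
lemma IsCoveredDomain.pos {α β : ℝ} (hα : 0 < α) (hβ : 0 < β) {P : Set Plane}
    (hP : IsCoveredDomain α β P) : 0 < Metric.diam P ∧ β ≤ 1 ∧ 0 < Real.sin α := by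
  have hne : (frontier P).Nonempty := by
    refine nonempty_frontier_iff.2 ⟨hP.isConnected.nonempty, fun h => ?_⟩
    exact noncompact_univ Plane (h ▸ hP.isCompact)
  obtain ⟨z, hz⟩ := hne
  obtain ⟨q, r, hfat, hsub, hq, -, hr⟩ := hP.exists_triangle z hz
  have hzq : z ≠ q := fun h => by
    have := hfat.1.injective (a₁ := 0) (a₂ := 1) (by simpa using h)
    simp at this
  have hle : dist z q ≤ Metric.diam P := Metric.dist_le_diam_of_mem hP.isCompact.isBounded
    (hsub (subset_convexHull ℝ _ (by simp))) (hsub (subset_convexHull ℝ _ (by simp)))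
  have hdiam : 0 < Metric.diam P := (dist_pos.2 hzq).trans_le hle
  exact ⟨hdiam, by nlinarith, (hfat.exists_disk hα (by positivity) hq hr).1⟩

/-! ### Packing for the truncated geodesic distance. -/

/-- A `σ`-separated family of points in a disk of radius `R` in the plane has at most
`(4R/σ + 2)²` members. -/
lemma card_le_of_separated_of_dist_le {ι : Type*} (X : Finset ι) (w : ι → Plane) (p : Plane)
    {R σ : ℝ} (hσ : 0 < σ) (hR : ∀ x ∈ X, dist (w x) p ≤ R)
    (hsep : ∀ x ∈ X, ∀ y ∈ X, x ≠ y → σ < dist (w x) (w y)) :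
    (X.card : ℝ) ≤ (4 * R / σ + 2) ^ 2 := by
  rcases X.eq_empty_or_nonempty with rfl | ⟨x₀, hx₀⟩
  · simpa using sq_nonneg _
  have hR0 : 0 ≤ R := dist_nonneg.trans (hR x₀ hx₀)
  -- Grid cells of side `σ / 2` have diameter below `σ`, so each contains at most one member.
  let g : ι → Fin 2 → ℤ := fun x k => ⌊(w x k - p k) / (σ / 2)⌋
  set b : ℝ := R / (σ / 2) with hb
  have hb0 : 0 ≤ b := by positivity
  let I : Finset ℤ := Finset.Icc ⌊-b⌋ ⌊b⌋
  have hmaps : ∀ x ∈ X, g x ∈ Fintype.piFinset fun _ : Fin 2 => I := by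
    intro x hx
    rw [Fintype.mem_piFinset]
    intro k
    have h1 : |w x k - p k| ≤ R := by
      have := PiLp.norm_apply_le (w x - p) k
      rw [← dist_eq_norm] at this
      exact this.trans (hR x hx)
    have h2 := abs_le.1 h1
    refine Finset.mem_Icc.2 ⟨Int.floor_mono ?_, Int.floor_mono ?_⟩
    · rw [hb, ← neg_div]
      gcongr
      exact h2.1
    · rw [hb]
      gcongr
      exact h2.2
  have hinj : Set.InjOn g X := by
    intro x hx y hy hxy
    by_contra hne
    have hk : ∀ k, |w x k - w y k| < σ / 2 := by
      intro k
      have h1 := Int.abs_sub_lt_one_of_floor_eq_floor (congrFun hxy k)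
      rw [← sub_div, abs_div, abs_of_pos (half_pos hσ), div_lt_one (half_pos hσ)] at h1
      simpa using h1
    have h1 := hsep x hx y hy hne
    have h2 : dist (w x) (w y) ^ 2 = (w x 0 - w y 0) ^ 2 + (w x 1 - w y 1) ^ 2 := by
      rw [dist_eq_norm, EuclideanSpace.norm_sq_eq]
      simp [Fin.sum_univ_two]
    have h3 := sq_lt_sq' (abs_lt.1 (hk 0)).1 (abs_lt.1 (hk 0)).2
    have h4 := sq_lt_sq' (abs_lt.1 (hk 1)).1 (abs_lt.1 (hk 1)).2
    nlinarith
  have hcard := Finset.card_le_card_of_injOn g hmaps hinj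
  rw [Fintype.card_piFinset_const, Int.card_Icc] at hcard
  have hI : ((⌊b⌋ + 1 - ⌊-b⌋).toNat : ℝ) ≤ 4 * R / σ + 2 := by
    have h0 : (0 : ℤ) ≤ ⌊b⌋ + 1 - ⌊-b⌋ := by
      have : ⌊-b⌋ ≤ ⌊b⌋ := Int.floor_mono (by linarith)
      omega
    have h1 : ((⌊b⌋ + 1 - ⌊-b⌋).toNat : ℝ) = ((⌊b⌋ + 1 - ⌊-b⌋ : ℤ) : ℝ) := by
      exact_mod_cast congrArg (fun z : ℤ => (z : ℝ)) (Int.toNat_of_nonneg h0)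
    rw [h1]
    push_cast
    have h2 := Int.floor_le b
    have h3 := Int.lt_floor_add_one (-b)
    have h4 : 4 * R / σ = 2 * b := by rw [hb]; field_simp; ring
    rw [h4]
    linarith
  calc (X.card : ℝ) ≤ ((⌊b⌋ + 1 - ⌊-b⌋).toNat : ℝ) ^ 2 := by exact_mod_cast hcard
    _ ≤ (4 * R / σ + 2) ^ 2 := by gcongr

/-- The geodesic distance truncated at the Euclidean diameter of the domain, as a real number. -/
noncomputable def truncDist (P : Set Plane) (p q : Plane) : ℝ :=
  (min (gdist P p q) (ENNReal.ofReal (Metric.diam P))).toReal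

lemma ofReal_truncDist (P : Set Plane) (p q : Plane) :
    ENNReal.ofReal (truncDist P p q) = min (gdist P p q) (ENNReal.ofReal (Metric.diam P)) :=
  ENNReal.ofReal_toReal (min_lt_of_right_lt ENNReal.ofReal_lt_top).ne

lemma truncDist_nonneg (P : Set Plane) (p q : Plane) : 0 ≤ truncDist P p q :=
  ENNReal.toReal_nonneg

lemma truncDist_le_diam (P : Set Plane) (p q : Plane) : truncDist P p q ≤ Metric.diam P := by
  refine (ENNReal.ofReal_le_ofReal_iff Metric.diam_nonneg).1 ?_
  rw [ofReal_truncDist]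
  exact min_le_right _ _

lemma truncDist_comm (P : Set Plane) (p q : Plane) : truncDist P p q = truncDist P q p := by
  rw [truncDist, truncDist, gdist_comm]

lemma truncDist_triangle (P : Set Plane) (p q r : Plane) :
    truncDist P p r ≤ truncDist P p q + truncDist P q r := by
  refine (ENNReal.ofReal_le_ofReal_iff
    (add_nonneg (truncDist_nonneg P p q) (truncDist_nonneg P q r))).1 ?_
  rw [ENNReal.ofReal_add (truncDist_nonneg P p q) (truncDist_nonneg P q r), ofReal_truncDist,
    ofReal_truncDist, ofReal_truncDist]
  rcases le_total (gdist P p q) (ENNReal.ofReal (Metric.diam P)) with h1 | h1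
  · rcases le_total (gdist P q r) (ENNReal.ofReal (Metric.diam P)) with h2 | h2
    · rw [min_eq_left h1, min_eq_left h2]
      exact (min_le_left _ _).trans (gdist_triangle P p q r)
    · rw [min_eq_right h2]
      exact (min_le_right _ _).trans le_add_self
  · rw [min_eq_right h1]
    exact (min_le_right _ _).trans le_self_add

lemma truncDist_self {P : Set Plane} {p : Plane} (h : p ∈ P) : truncDist P p p = 0 := by
  simp [truncDist, gdist_self h]

lemma dist_le_truncDist {P : Set Plane} (hP : Bornology.IsBounded P) {p q : Plane} (hp : p ∈ P)
    (hq : q ∈ P) : dist p q ≤ truncDist P p q := by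
  refine (ENNReal.ofReal_le_ofReal_iff (truncDist_nonneg P p q)).1 ?_
  rw [ofReal_truncDist, ← edist_dist, le_min_iff]
  refine ⟨edist_le_gdist P p q, ?_⟩
  rw [edist_dist]
  exact ENNReal.ofReal_le_ofReal (Metric.dist_le_diam_of_mem hP hp hq)

lemma truncDist_le {P : Set Plane} {p q : Plane} {t : ℝ} (ht : 0 ≤ t)
    (h : gdist P p q ≤ ENNReal.ofReal t) : truncDist P p q ≤ t := by
  refine (ENNReal.ofReal_le_ofReal_iff ht).1 ?_
  rw [ofReal_truncDist]
  exact (min_le_left _ _).trans h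

/-- Well-separatedness transfers from the truncated to the geodesic distance. -/
lemma mul_gdist_le_of_mul_truncDist_le {P : Set Plane} (hP : 0 < Metric.diam P) {s : ℝ}
    (hs : 1 < s) {u v a b : Plane} (h : s * truncDist P u v ≤ truncDist P a b) :
    ENNReal.ofReal s * gdist P u v ≤ gdist P a b := by
  -- Since `s > 1`, the smaller distance is strictly below the cap, so truncation did not change it.
  have hlt : truncDist P u v < Metric.diam P := by
    have := truncDist_le_diam P a b
    nlinarith [truncDist_nonneg P u v]
  have h1 := ofReal_truncDist P u v
  have h2 := (ENNReal.ofReal_lt_ofReal_iff hP).2 hlt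
  rw [h1, min_lt_iff] at h2
  rw [min_eq_left (h2.resolve_right (lt_irrefl _)).le] at h1
  rw [← h1, ← ENNReal.ofReal_mul (by linarith)]
  calc ENNReal.ofReal (s * truncDist P u v) ≤ ENNReal.ofReal (truncDist P a b) :=
        ENNReal.ofReal_le_ofReal h
    _ ≤ gdist P a b := by rw [ofReal_truncDist]; exact min_le_left _ _

/-- The packing property of the geodesic distance in a covered domain. -/
lemma IsCoveredDomain.card_le {α β : ℝ} (hα : 0 < α) (hβ : 0 < β) {P : Set Plane}
    (hP : IsCoveredDomain α β P) {x : Plane} (hx : x ∈ P) {r B : ℝ} (hr : 0 < r) (hB : 1 ≤ B)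
    (X : Finset Plane) (hX : (X : Set Plane) ⊆ P) (hball : ∀ y ∈ X, truncDist P x y ≤ B * r)
    (hsep : ∀ y ∈ X, ∀ z ∈ X, y ≠ z → r < truncDist P y z) :
    (X.card : ℝ) ≤ (300 / (Real.sin α * β)) ^ 2 * B ^ 2 := by
  obtain ⟨hdiam, hβ1, hsin⟩ := hP.pos hα hβ
  set Δ := Metric.diam P
  have hsin1 := Real.sin_le_one α
  have hbd := hP.isCompact.isBounded
  -- The factor `1/5` makes two steps of length `2ρ` shorter than `r`; the other bound is the size
  -- guaranteed for the triangles.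
  set ρ := min (r / 5) (β * Δ) with hρdef
  have hρ : 0 < ρ := by positivity
  have hρr : ρ ≤ r / 5 := min_le_left _ _
  have hρβ : ρ ≤ β * Δ := min_le_right _ _
  set σ := Real.sin α / 6 * ρ with hσdef
  have hσ : 0 < σ := by positivity
  have hw : ∀ y, ∃ w : Plane, y ∈ P → ∀ z, dist z w ≤ σ →
      z ∈ P ∧ gdist P y z ≤ ENNReal.ofReal (2 * ρ) := by
    intro y
    by_cases hy : y ∈ P
    · obtain ⟨w, h⟩ := hP.exists_disk hα hρ hρβ hy
      exact ⟨w, fun _ => h⟩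
    · exact ⟨y, fun h => absurd h hy⟩
  choose w hw using hw
  have hself : ∀ y ∈ P, w y ∈ P ∧ truncDist P y (w y) ≤ 2 * ρ := fun y hy => by
    obtain ⟨h1, h2⟩ := hw y hy (w y) (by rw [dist_self]; exact hσ.le)
    exact ⟨h1, truncDist_le (by positivity) h2⟩
  have hwsep : ∀ y ∈ X, ∀ z ∈ X, y ≠ z → σ < dist (w y) (w z) := by
    intro y hy z hz hyz
    by_contra! hcon
    have h1 := (hself z (hX hz)).2
    have h2 := truncDist_le (by positivity) (hw y (hX hy) (w z) (by rwa [dist_comm])).2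
    have h3 := truncDist_triangle P y (w z) z
    rw [truncDist_comm P (w z) z] at h3
    have := hsep y hy z hz hyz
    linarith
  -- Capping at `Δ` keeps `R / ρ` of order `B` even when `r` is so large that `ρ = β * Δ`.
  set R := min (2 * (B * r)) Δ with hR
  have hwR : ∀ y ∈ X, dist (w y) x ≤ R := by
    intro y hy
    obtain ⟨h1, h2⟩ := hself y (hX hy)
    refine le_min ?_ (Metric.dist_le_diam_of_mem hbd h1 hx)
    have h3 := dist_le_truncDist hbd hx h1
    have h4 := truncDist_triangle P x y (w y)
    have h5 := hball y hy
    rw [dist_comm]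
    nlinarith
  have hmain := card_le_of_separated_of_dist_le X w x hσ hwR hwsep
  have hRρ : R * β ≤ 10 * B * ρ := by
    rcases min_cases (r / 5) (β * Δ) with ⟨h, -⟩ | ⟨h, -⟩
    · rw [hρdef, h]
      have : R ≤ 2 * (B * r) := min_le_left _ _
      have : 0 ≤ B * r := by positivity
      nlinarith
    · rw [hρdef, h]
      have : R ≤ Δ := min_le_right _ _
      have : 0 ≤ β * Δ := by positivity
      nlinarith
  have hq : 4 * R / σ ≤ 240 * B / (Real.sin α * β) := by
    rw [div_le_div_iff₀ hσ (by positivity), hσdef]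
    nlinarith
  have h2 : 2 ≤ 60 * B / (Real.sin α * β) := by
    rw [le_div_iff₀ (by positivity)]
    nlinarith
  have hR0 : 0 ≤ R := le_min (by positivity) hdiam.le
  calc (X.card : ℝ) ≤ (4 * R / σ + 2) ^ 2 := hmain
    _ ≤ (240 * B / (Real.sin α * β) + 60 * B / (Real.sin α * β)) ^ 2 := by gcongr
    _ = (300 / (Real.sin α * β)) ^ 2 * B ^ 2 := by ring

/-- Linear-size well-separated pair decompositions for the geodesic distance in a covered
domain. -/
theorem IsCoveredDomain.exists_isWSPD {α β : ℝ} (hα : 0 < α) (hβ : 0 < β) {P : Set Plane}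
    (hP : IsCoveredDomain α β P) (S : Finset Plane) (hS : (S : Set Plane) ⊆ P) {s : ℝ}
    (hs : 1 < s) :
    ∃ W, IsWSPD P s S W ∧
      (W.card : ℝ) ≤ 16800 * (300 / (Real.sin α * β)) ^ 2 * S.card * s ^ 3 := by
  have hdiam := (hP.pos hα hβ).1
  classical
  let _ : LinearOrder Plane := linearOrderOfSTO WellOrderingRel
  obtain ⟨W, h1, h2, h3, h4, h5, h6⟩ := exists_wspd_of_packing (truncDist P) (truncDist_comm P)
    (truncDist_triangle P) S (fun x hx => truncDist_self (hS hx))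
    (fun x hx y hy hxy => (dist_pos.2 hxy).trans_le
      (dist_le_truncDist hP.isCompact.isBounded (hS hx) (hS hy)))
    ((300 / (Real.sin α * β)) ^ 2) (by positivity)
    (fun x hx r B hr hB X hX hball hsep => hP.card_le hα hβ (hS hx) hr hB X
      ((Finset.coe_subset.2 hX).trans hS) hball hsep) s hs
  refine ⟨W, ⟨h1, h2, h3, fun X hX => ?_, h5⟩, h6⟩
  refine le_iInf₂ fun a ha => le_iInf₂ fun b hb => ?_
  obtain ⟨h7, h8⟩ := h4 X hX a ha b hb
  rw [mul_max, max_le_iff]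
  simp only [gdiam, ENNReal.mul_iSup, iSup_le_iff]
  exact ⟨fun u hu v hv => mul_gdist_le_of_mul_truncDist_le hdiam hs (h7 u hu v hv),
    fun u hu v hv => mul_gdist_le_of_mul_truncDist_le hdiam hs (h8 u hu v hv)⟩

/-! ### Weighted graph distances and spanners. -/

section GraphDist

variable {V : Type*} {G : SimpleGraph V} {w : V → V → ℝ≥0∞}

lemma graphDist_triangle (u v x : V) :
    graphDist G w u x ≤ graphDist G w u v + graphDist G w v x := by
  unfold graphDist
  simp only [ENNReal.iInf_add, ENNReal.add_iInf]
  refine le_iInf fun p => le_iInf fun q => (iInf_le _ (q.append p)).trans ?_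
  simp [walkWeight, SimpleGraph.Walk.darts_append]

lemma graphDist_self (u : V) : graphDist G w u u = 0 :=
  le_antisymm ((iInf_le _ SimpleGraph.Walk.nil).trans (by simp [walkWeight])) zero_le

lemma graphDist_le_of_adj {u v : V} (h : G.Adj u v) : graphDist G w u v ≤ w u v :=
  (iInf_le _ h.toWalk).trans (by simp [walkWeight])

/-- The triangle inequality shortcuts any walk to the direct edge, so a spanner need only be
compared with the edge weights. -/
lemma le_graphDist (hself : ∀ u, w u u = 0) (htri : ∀ u v x, w u x ≤ w u v + w v x) (u v : V) :
    w u v ≤ graphDist G w u v := by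
  refine le_iInf fun p => ?_
  induction p with
  | nil => simp [hself]
  | @cons u v x h p ih =>
    refine (htri u v x).trans ?_
    simp only [walkWeight, SimpleGraph.Walk.darts_cons, List.map_cons, List.sum_cons]
    gcongr
    exact ih

end GraphDist

/-- One edge per pair of a well-separated pair decomposition gives a spanner. -/
theorem IsWSPD.exists_isSpanner {P : Set Plane} {S : Finset Plane} (hS : (S : Set Plane) ⊆ P)
    {ε : ℝ} (hε : 0 < ε) (hε1 : ε ≤ 1) {W : Finset (Finset Plane × Finset Plane)}
    (hW : IsWSPD P (6 / ε) S W) :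
    ∃ H : SimpleGraph S, IsSpanner (⊤ : SimpleGraph S) (fun p q => gdist P p q) (1 + ε) H ∧
      H.edgeSet.ncard ≤ W.card := by
  classical
  have hrep : ∀ X : W, ∃ e : S × S, (e.1 : Plane) ∈ X.1.1 ∧ (e.2 : Plane) ∈ X.1.2 := by
    intro X
    obtain ⟨⟨a, ha⟩, ⟨b, hb⟩⟩ := hW.nonempty X X.2
    exact ⟨(⟨a, (hW.subset X X.2).1 ha⟩, ⟨b, (hW.subset X X.2).2 hb⟩), ha, hb⟩
  choose e he1 he2 using hrep
  let E : Set (Sym2 S) := Set.range fun X : W => s((e X).1, (e X).2)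
  have hEfin : E.Finite := Set.finite_range _
  let H := SimpleGraph.fromEdgeSet E
  refine ⟨H, ⟨le_top, ?_⟩, ?_⟩
  swap
  · have h1 : H.edgeSet ⊆ E := by
      rw [SimpleGraph.edgeSet_fromEdgeSet]
      exact Set.sdiff_subset
    calc H.edgeSet.ncard ≤ E.ncard := Set.ncard_le_ncard h1 hEfin
      _ ≤ (Set.univ : Set W).ncard := by
        rw [show E = (fun X : W => s((e X).1, (e X).2)) '' Set.univ from Set.image_univ.symm]
        exact Set.ncard_image_le Set.finite_univ
      _ = W.card := by rw [Set.ncard_univ, Nat.card_eq_fintype_card, Fintype.card_coe]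
  set w : S → S → ℝ≥0∞ := fun p q => gdist P p q with hw
  have hadj : ∀ X : W, graphDist H w (e X).1 (e X).2 ≤ w (e X).1 (e X).2 ∧
      graphDist H w (e X).2 (e X).1 ≤ w (e X).1 (e X).2 := by
    intro X
    have hne : (e X).1 ≠ (e X).2 := fun h =>
      Finset.disjoint_left.1 (hW.disjoint X X.2) (he1 X) (h ▸ he2 X)
    have : H.Adj (e X).1 (e X).2 := (SimpleGraph.fromEdgeSet_adj E).2 ⟨⟨X, rfl⟩, hne⟩
    refine ⟨graphDist_le_of_adj this, (graphDist_le_of_adj this.symm).trans ?_⟩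
    exact (gdist_comm P _ _).le
  have hwself : ∀ u, w u u = 0 := fun u => gdist_self (hS u.2)
  have hwtri : ∀ u v x, w u x ≤ w u v + w v x := fun u v x => gdist_triangle P u v x
  have hwcomm : ∀ u v, w u v = w v u := fun u v => gdist_comm P u v
  have hwpos : ∀ u v, u ≠ v → 0 < w u v := fun u v huv =>
    (edist_pos.2 fun h => huv (Subtype.ext h)).trans_le (edist_le_gdist P u v)
  -- two points `p`, `q` have representatives much closer to them than `w p q`
  have hpair : ∀ p q : S, p ≠ q → ∃ a b : S, graphDist H w a b ≤ w a b ∧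
      ENNReal.ofReal (6 / ε) * w p a ≤ w p q ∧ ENNReal.ofReal (6 / ε) * w b q ≤ w p q := by
    intro p q hpq
    obtain ⟨X, ⟨hX, hcase⟩, -⟩ := hW.existsUnique_pair p p.2 q q.2 fun h => hpq (Subtype.ext h)
    have hsep := hW.wellSeparated X hX
    have hd : ∀ A : Finset Plane, ∀ u v : S, (u : Plane) ∈ A → (v : Plane) ∈ A →
        w u v ≤ gdiam P A := fun A u v hu hv =>
      le_iSup₂_of_le (u : Plane) hu (le_iSup₂_of_le (v : Plane) hv le_rfl)
    have hs : ∀ u v : S, (u : Plane) ∈ X.1 → (v : Plane) ∈ X.2 →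
        gsetDist P X.1 X.2 ≤ w u v := fun u v hu hv =>
      iInf₂_le_of_le (u : Plane) hu (iInf₂_le_of_le (v : Plane) hv le_rfl)
    have h1 : ENNReal.ofReal (6 / ε) * gdiam P X.1 ≤ gsetDist P X.1 X.2 :=
      le_trans (by gcongr; exact le_max_left _ _) hsep
    have h2 : ENNReal.ofReal (6 / ε) * gdiam P X.2 ≤ gsetDist P X.1 X.2 :=
      le_trans (by gcongr; exact le_max_right _ _) hsep
    rcases hcase with ⟨hp, hq⟩ | ⟨hq, hp⟩
    · refine ⟨(e ⟨X, hX⟩).1, (e ⟨X, hX⟩).2, (hadj ⟨X, hX⟩).1, ?_, ?_⟩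
      · exact le_trans (by gcongr; exact hd X.1 _ _ hp (he1 ⟨X, hX⟩)) (h1.trans (hs p q hp hq))
      · exact le_trans (by gcongr; exact hd X.2 _ _ (he2 ⟨X, hX⟩) hq) (h2.trans (hs p q hp hq))
    · refine ⟨(e ⟨X, hX⟩).2, (e ⟨X, hX⟩).1, (hadj ⟨X, hX⟩).2.trans (hwcomm _ _).le, ?_, ?_⟩
      · rw [hwcomm p q]
        exact le_trans (by gcongr; exact hd X.2 _ _ hp (he2 ⟨X, hX⟩)) (h2.trans (hs q p hq hp))
      · rw [hwcomm p q]
        exact le_trans (by gcongr; exact hd X.1 _ _ (he1 ⟨X, hX⟩) hq) (h1.trans (hs q p hq hp))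
  have main : ∀ p q : S, graphDist H w p q ≤ ENNReal.ofReal (1 + ε) * w p q := by
    -- Induction on the distance of a pair, which is legitimate because there are finitely many
    -- pairs. The pairs `(p, a)` and `(b, q)` are closer by the factor `ε / 6`.
    have hwf : WellFounded fun x y : S × S => w x.1 x.2 < w y.1 y.2 :=
      Finite.wellFounded_of_trans_of_irrefl (r := fun x y : S × S => w x.1 x.2 < w y.1 y.2)
    suffices ∀ x : S × S, graphDist H w x.1 x.2 ≤ ENNReal.ofReal (1 + ε) * w x.1 x.2 from
      fun p q => this (p, q)
    intro x
    induction x using hwf.induction with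
    | _ x ih =>
    obtain ⟨p, q⟩ := x
    simp only at ih ⊢
    rcases eq_or_ne p q with rfl | hpq
    · rw [graphDist_self]
      exact zero_le
    rcases eq_or_ne (w p q) ⊤ with htop | htop
    · rw [htop, ENNReal.mul_top (by simp; linarith)]
      exact le_top
    obtain ⟨a, b, hab, hpa, hbq⟩ := hpair p q hpq
    have hpos := hwpos p q hpq
    set D := (w p q).toReal with hD
    have hDpos : 0 < D := ENNReal.toReal_pos hpos.ne' htop
    have hwD : w p q = ENNReal.ofReal D := (ENNReal.ofReal_toReal htop).symm
    have hsmall : ∀ t : ℝ≥0∞, ENNReal.ofReal (6 / ε) * t ≤ w p q →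
        t ≤ ENNReal.ofReal (ε / 6 * D) := by
      intro t ht
      have h6 : 0 < 6 / ε := by positivity
      have : ENNReal.ofReal (ε / 6) * (ENNReal.ofReal (6 / ε) * t) = t := by
        rw [← mul_assoc, ← ENNReal.ofReal_mul (by positivity),
          show ε / 6 * (6 / ε) = 1 by field_simp, ENNReal.ofReal_one, one_mul]
      rw [← this, ENNReal.ofReal_mul (by positivity), ← hwD]
      gcongr
    have hpa' := hsmall _ hpa
    have hbq' := hsmall _ hbq
    have hlt : ENNReal.ofReal (ε / 6 * D) < w p q := by
      rw [hwD]
      exact (ENNReal.ofReal_lt_ofReal_iff hDpos).2 (by nlinarith)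
    have h1 := ih (p, a) (hpa'.trans_lt hlt)
    have h2 := ih (b, q) (hbq'.trans_lt hlt)
    simp only at h1 h2
    have hwab : w a b ≤ ENNReal.ofReal (ε / 6 * D) + ENNReal.ofReal D + ENNReal.ofReal (ε / 6 * D) :=
      calc w a b ≤ w a p + w p b := hwtri _ _ _
        _ ≤ w a p + (w p q + w q b) := by gcongr; exact hwtri _ _ _
        _ = w p a + w p q + w b q := by rw [hwcomm a p, hwcomm q b, add_assoc]
        _ ≤ _ := by rw [hwD]; gcongr
    have hx : 0 ≤ ε / 6 * D := by positivity
    calc graphDist H w p q ≤ graphDist H w p a + graphDist H w a q := graphDist_triangle _ _ _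
      _ ≤ graphDist H w p a + (graphDist H w a b + graphDist H w b q) := by
        gcongr
        exact graphDist_triangle _ _ _
      _ ≤ ENNReal.ofReal (1 + ε) * ENNReal.ofReal (ε / 6 * D) +
          ((ENNReal.ofReal (ε / 6 * D) + ENNReal.ofReal D + ENNReal.ofReal (ε / 6 * D)) +
            ENNReal.ofReal (1 + ε) * ENNReal.ofReal (ε / 6 * D)) :=
        add_le_add (h1.trans (by gcongr))
          (add_le_add (hab.trans hwab) (h2.trans (by gcongr)))
      _ = ENNReal.ofReal ((1 + ε) * (ε / 6 * D) +
          ((ε / 6 * D + D + ε / 6 * D) + (1 + ε) * (ε / 6 * D))) := by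
        have hy : 0 ≤ (1 + ε) * (ε / 6 * D) := by positivity
        rw [← ENNReal.ofReal_mul (p := 1 + ε) (by positivity), ENNReal.ofReal_add hy (by positivity),
          ENNReal.ofReal_add (p := ε / 6 * D + D + ε / 6 * D) (by positivity) hy,
          ENNReal.ofReal_add (p := ε / 6 * D + D) (by positivity) hx,
          ENNReal.ofReal_add hx hDpos.le]
      _ ≤ ENNReal.ofReal ((1 + ε) * D) := by
        -- The total is `(1 + 2ε/3 + ε²/3) * D`, and `ε² ≤ ε`.
        refine ENNReal.ofReal_le_ofReal ?_
        have : 0 ≤ ε * D * (1 - ε) := mul_nonneg (by positivity) (by linarith)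
        nlinarith
      _ = ENNReal.ofReal (1 + ε) * w p q := by rw [ENNReal.ofReal_mul (by positivity), ← hwD]
  intro u v
  refine (main u v).trans ?_
  gcongr
  exact le_graphDist hwself hwtri u v

theorem mainTheorem5 (α β : ℝ) (hα : 0 < α) (hβ : 0 < β) :
    ∃ (C : ℝ) (k : ℕ), ∀ (P : Set Plane), IsCoveredDomain α β P →
      ∀ S : Finset Plane, (S : Set Plane) ⊆ P →
        (∀ ε : ℝ, 0 < ε → ε ≤ 1 →
          ∃ H : SimpleGraph S,
            IsSpanner (⊤ : SimpleGraph S) (fun p q => gdist P p q) (1 + ε) H ∧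
            (H.edgeSet.ncard : ℝ) ≤ C * S.card * (1 / ε) ^ k) ∧
        (∀ s : ℝ, 1 < s →
          ∃ W : Finset (Finset Plane × Finset Plane),
            IsWSPD P s S W ∧ (W.card : ℝ) ≤ C * S.card * s ^ k) := by
  set K : ℝ := 16800 * (300 / (Real.sin α * β)) ^ 2 with hK
  have hK0 : 0 ≤ K := by positivity
  -- Here `216 = 6 ^ 3` comes from using separation `6 / ε` for the spanner.
  refine ⟨216 * K, 3, fun P hP S hS => ⟨fun ε hε hε1 => ?_, fun s hs => ?_⟩⟩
  · obtain ⟨W, hW, hcard⟩ := hP.exists_isWSPD hα hβ S hS (s := 6 / ε)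
      (by rw [lt_div_iff₀ hε]; linarith)
    obtain ⟨H, hH, hHcard⟩ := hW.exists_isSpanner hS hε hε1
    refine ⟨H, hH, ?_⟩
    calc (H.edgeSet.ncard : ℝ) ≤ W.card := by exact_mod_cast hHcard
      _ ≤ K * S.card * (6 / ε) ^ 3 := hcard
      _ = 216 * K * S.card * (1 / ε) ^ 3 := by ring
  · obtain ⟨W, hW, hcard⟩ := hP.exists_isWSPD hα hβ S hS hs
    refine ⟨W, hW, hcard.trans ?_⟩
    have : 0 ≤ K * S.card * s ^ 3 := by positivity
    linarith
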